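/- Let $\mathcal E$ be a finite set of basic events, $\Omega=\{0,1\}^{\mathcal E}$ the set of states, and call the subsets of $\Omega$ events; each event is a Boolean combination of basic events. Formulas of past-time temporal logic $\mathrm{TL}$ are built from basic events and $\mathit{true}$ by $\lnot,\lor,\bullet$ (previously) and $\mathsf S$ (since), and are interpreted at the positions of nonempty finite words over $\Omega$; $\Diamond\varphi$ ("once $\varphi$") is $\mathit{true}\,\mathsf S\,\varphi$. For $\varphi,\psi\in\mathrm{TL}$, the conditional $(\varphi|\psi)$ is the function $c:\Omega^+\to\{0,1,\bot\}$ whose value on a word is, at its last position, $1$ if $\varphi\land\psi$ holds, $0$ if $\lnot\varphi\land\psi$ holds, and $\bot$ (undefined) if $\psi$ fails. Given a probability measure $\Pr$ on $\Omega$, put the product measure on $\Omega^\infty$ and let $c_n(w)$ be the value of $c$ on the prefix of $w$ of length $n$. The asymptotic probability of $c$ is $\Pr(c)=\lim_{n\to\infty}\Pr(c_n=1)/\Pr(c_n\in\{0,1\})$, provided that the denominator is nonzero for all large $n$ and the limit exists. Conditional expressions are built from simple conditionals $(a|b)$, with $a,b$ events, by $\land,\lor,\sim$. The product space semantics is $[\![(a|b)]\!]=\bigcup_{j\ge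 0}(\Omega\setminus b)^j\times(b\cap a)\times\Omega\times\Omega\times\cdots\subseteq\Omega^\infty$, with $\land,\lor,\sim$ interpreted as intersection, union and complement, and $\Pr_o(e)$ is the product measure of $[\![e]\!]$. Let $e$ be an expression whose simple conditionals are $(a_1|b_1),\dots,(a_m|b_m)$. Let $e^{F}$ and $e^{R}$ be the $\mathrm{TL}$ formulas obtained from $e$ by replacing each $(a_i|b_i)$ by $\Diamond(a_i\land b_i\land\lnot\bullet\Diamond b_i)$ and by $(\lnot b_i)\,\mathsf S\,(a_i\land b_i)$, respectively, and reading $\land,\lor,\sim$ as the Boolean connectives. The first embedding of $e$ is $(e^F|\mathit{true})$, and the sparse reverse interpretation of $e$ is $$e^{S}=\Bigl(e^{R}\,\Big|\,\bigvee_{i=1}^m(b_i\lor\lnot\Diamond b_i)\Bigr).$$ Theorem. (1) For every conditional expression $e$ and every probability measure $\Pr$ on $\Omega$, the asymptotic probabilities of $e^S$ and of $(e^F|\mathit{true})$ exist, and $\Pr(e^S)=\Pr_o(e)=\Pr((e^F|\mathit{true}))$. (2) If $\Pr(b_i)>0$ for all $i$, then $\lim_{n\to\infty}\Pr(e^S_n=\bot)=1-\Pr(b_1\cup\dots\cup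 b_m)$. If $\mathcal E\neq\varnothing$, there are $\Pr$ and $e$ for which $\lim_{n\to\infty}\Pr(e^S_n=\bot)$ exists and is positive. (3) The interpretation $e\mapsto e^S$ is not an embedding: for distinct basic events $a,b$ we have $[\![(\varnothing|a)]\!]=[\![(\varnothing|b)]\!]$, but $(\varnothing|a)^S\ne(\varnothing|b)^S$ as functions on $\Omega^+$. -/

import Mathlib

open MeasureTheory Filter Topology

namespace CondTL

/-- A state assigns a truth value to every basic event. The states are the atoms of the Boolean
algebra generated by the basic events, and the events are the sets of states. -/
abbrev State (E : Type*) := E → Bool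

/-- The event named by a basic event. -/
def basic {E : Type*} (x : E) : Set (State E) := {ω | ω x = true}

/-- Formulas of temporal logic of linear discrete past time. -/
inductive TL (E : Type*) where
  | verum : TL E
  | atom : E → TL E
  | neg : TL E → TL E
  | or : TL E → TL E → TL E
  | prev : TL E → TL E
  | since : TL E → TL E → TL E

namespace TL

variable {E : Type*}

def and (φ ψ : TL E) : TL E := neg (or (neg φ) (neg ψ))

/-- "Once `φ`": `true Since φ`. -/
def once (φ : TL E) : TL E := since verum φ

def bigOr (l : List (TL E)) : TL E := l.foldr or (neg verum)

def bigAnd (l : List (TL E)) : TL E := l.foldr and verum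

/-- `M, s ⊨ φ` for a model `M = s_0, …, s_n`. -/
def Sat {n : ℕ} (M : Fin (n + 1) → State E) : TL E → Fin (n + 1) → Prop
  | verum, _ => True
  | atom x, s => M s x = true
  | neg φ, s => ¬ Sat M φ s
  | or φ ψ, s => Sat M φ s ∨ Sat M ψ s
  | prev φ, s => ∃ t : Fin (n + 1), (t : ℕ) + 1 = s ∧ Sat M φ t
  | since φ ψ, s => ∃ t ≤ s, Sat M ψ t ∧ ∀ u, t < u → u ≤ s → Sat M φ u

/-- The conjunction of literals that describes one state. -/
noncomputable def ofState [Fintype E] (ω : State E) : TL E :=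
  bigAnd (Finset.univ.toList.map fun x => if ω x then atom x else neg (atom x))

/-- An event as a Boolean combination of basic events (full disjunctive normal form). -/
noncomputable def ofEvent [Fintype E] (a : Set (State E)) : TL E :=
  bigOr ((Set.toFinite a).toFinset.toList.map ofState)

theorem sat_and {n : ℕ} (M : Fin (n + 1) → State E) (φ ψ : TL E) (s : Fin (n + 1)) :
    Sat M (and φ ψ) s ↔ Sat M φ s ∧ Sat M ψ s := by
  simp [and, Sat]

theorem sat_bigOr {n : ℕ} (M : Fin (n + 1) → State E) (l : List (TL E)) (s : Fin (n + 1)) :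
    Sat M (bigOr l) s ↔ ∃ φ ∈ l, Sat M φ s := by
  induction l with
  | nil => simp [bigOr, Sat]
  | cons φ l ih =>
    have h : Sat M (bigOr (φ :: l)) s ↔ Sat M φ s ∨ Sat M (bigOr l) s := Iff.rfl
    rw [h, ih]; simp

theorem sat_bigAnd {n : ℕ} (M : Fin (n + 1) → State E) (l : List (TL E)) (s : Fin (n + 1)) :
    Sat M (bigAnd l) s ↔ ∀ φ ∈ l, Sat M φ s := by
  induction l with
  | nil => simp [bigAnd, Sat]
  | cons φ l ih =>
    have h : Sat M (bigAnd (φ :: l)) s ↔ Sat M φ s ∧ Sat M (bigAnd l) s := sat_and _ _ _ _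
    rw [h, ih]; simp

theorem sat_ofState [Fintype E] {n : ℕ} (M : Fin (n + 1) → State E) (ω : State E)
    (s : Fin (n + 1)) : Sat M (ofState ω) s ↔ M s = ω := by
  rw [ofState, sat_bigAnd, funext_iff]
  simp only [List.mem_map, Finset.mem_toList, Finset.mem_univ, true_and,
    forall_exists_index, forall_apply_eq_imp_iff]
  refine forall_congr' fun x => ?_
  cases h : ω x <;> simp [Sat]

theorem sat_ofEvent [Fintype E] {n : ℕ} (M : Fin (n + 1) → State E) (a : Set (State E))
    (s : Fin (n + 1)) : Sat M (ofEvent a) s ↔ M s ∈ a := by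
  rw [ofEvent, sat_bigOr]
  simp [sat_ofState]

end TL

/-- The truth values `0`, `1` and "undefined". -/
inductive Three where
  | zero
  | one
  | undef

/-- Nonempty finite words over the alphabet of states; `⟨n, w⟩` has length `n + 1`. -/
abbrev Word (E : Type*) := (n : ℕ) × (Fin (n + 1) → State E)

/-- A conditional formula `(φ | ψ)` with temporal formulas `φ`, `ψ`. -/
structure TLTL (E : Type*) where
  concl : TL E
  given : TL E

/-- The conditional object (three-valued function on words) defined by `(φ | ψ)`, evaluated at
the last state of the word. -/
noncomputable def TLTL.obj {E : Type*} (c : TLTL E) : Word E → Three :=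
  open Classical in fun w =>
    if c.given.Sat w.2 (Fin.last w.1) then
      if c.concl.Sat w.2 (Fin.last w.1) then Three.one else Three.zero
    else Three.undef

/-- Flat conditional expressions, built from simple conditionals `(a | b)` of events. -/
inductive CExpr (E : Type*) where
  | simple : Set (State E) → Set (State E) → CExpr E
  | and : CExpr E → CExpr E → CExpr E
  | or : CExpr E → CExpr E → CExpr E
  | neg : CExpr E → CExpr E

namespace CExpr

variable {E : Type*}

/-- The conditions `b_1, …, b_m` of the simple conditionals `(a_i | b_i)` occurring in `e`. -/
def conditions : CExpr E → List (Set (State E))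
  | simple _ b => [b]
  | and e e' => e.conditions ++ e'.conditions
  | or e e' => e.conditions ++ e'.conditions
  | neg e => e.conditions

/-- The product space semantics. -/
def ps : CExpr E → Set (ℕ → State E)
  | simple a b => ⋃ j : ℕ, {w | (∀ i < j, w i ∈ bᶜ) ∧ w j ∈ b ∩ a}
  | and e e' => e.ps ∩ e'.ps
  | or e e' => e.ps ∪ e'.ps
  | neg e => (e.ps)ᶜ

variable [Fintype E]

/-- Temporal part of the first embedding: `(a | b)` becomes `◇(a ∧ b ∧ ¬ prev ◇ b)`. -/
noncomputable def firstTL : CExpr E → TL E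
  | simple a b => TL.once (TL.and (TL.ofEvent a)
      (TL.and (TL.ofEvent b) (TL.neg (TL.prev (TL.once (TL.ofEvent b))))))
  | and e e' => TL.and e.firstTL e'.firstTL
  | or e e' => TL.or e.firstTL e'.firstTL
  | neg e => TL.neg e.firstTL

/-- The first embedding. -/
noncomputable def first (e : CExpr E) : TLTL E := ⟨e.firstTL, TL.verum⟩

/-- Temporal part of the reverse embedding: `(a | b)` becomes `bᶜ Since (a ∧ b)`. -/
noncomputable def revTL : CExpr E → TL E
  | simple a b => TL.since (TL.ofEvent bᶜ) (TL.and (TL.ofEvent a) (TL.ofEvent b))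
  | and e e' => TL.and e.revTL e'.revTL
  | or e e' => TL.or e.revTL e'.revTL
  | neg e => TL.neg e.revTL

/-- The sparse reverse interpretation: the reverse formula of `e` given `⋁ᵢ (bᵢ ∨ ¬ ◇ bᵢ)`. -/
noncomputable def sparse (e : CExpr E) : TLTL E :=
  ⟨e.revTL, TL.bigOr (e.conditions.map fun b =>
    TL.or (TL.ofEvent b) (TL.neg (TL.once (TL.ofEvent b))))⟩

end CExpr

variable {E : Type*}

/-- The product measure on infinite sequences of states. -/
noncomputable def seqMeasure (P : Measure (State E)) [IsProbabilityMeasure P] :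
    Measure (ℕ → State E) :=
  Measure.infinitePi fun _ : ℕ => P

/-- The value of the conditional object `c` on the prefix of length `n + 1`. -/
def valueAt (c : Word E → Three) (n : ℕ) (w : ℕ → State E) : Three :=
  c ⟨n, fun i => w i⟩

/-- The probability that `c` takes the value `v` on the prefix of length `n + 1`. -/
noncomputable def probAt (P : Measure (State E)) [IsProbabilityMeasure P]
    (c : Word E → Three) (n : ℕ) (v : Three) : ℝ :=
  (seqMeasure P).real {w | valueAt c n w = v}

/-- The probability that `c` is defined on the prefix of length `n + 1`. -/
noncomputable def probDefinedAt (P : Measure (State E)) [IsProbabilityMeasure P]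
    (c : Word E → Three) (n : ℕ) : ℝ :=
  (seqMeasure P).real {w | valueAt c n w = Three.zero ∨ valueAt c n w = Three.one}

/-- The asymptotic probability of `c` exists and equals `p`. -/
def HasAsympProb (P : Measure (State E)) [IsProbabilityMeasure P]
    (c : Word E → Three) (p : ℝ) : Prop :=
  (∀ᶠ n in atTop, probDefinedAt P c n ≠ 0) ∧
    Tendsto (fun n => probAt P c n Three.one / probDefinedAt P c n) atTop (𝓝 p)

/-- The probability of an expression in the product space conditional event algebra. -/
noncomputable def prPS (P : Measure (State E)) [IsProbabilityMeasure P] (e : CExpr E) : ℝ :=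
  (seqMeasure P).real e.ps

end CondTL

namespace CondTL

open ProbabilityTheory

variable {E : Type*}

/-! ### The product measure on sequences of states -/

section SeqMeasure

variable (P : Measure (State E)) [IsProbabilityMeasure P]

/-! Read backwards from its last position, a prefix turns `Since` into a first-occurrence condition,
so `revTL` becomes the truncated semantics `approx` and the sparse condition becomes `decided`. The
product measure is invariant under this reversal (`seqMeasure_real_flip`). The reversed events
stabilise pointwise to `ps` and `decidedLim`, so their probabilities converge. The first embedding
gives `approx` without reversal.

It remains to see that `ps` and `decidedLim` are independent and that the latter has positive
measure. Let `B` be the union of the conditions. If all conditions have positive probability,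
`decidedLim` is almost surely `{w 0 ∈ B}`. Outside `B` the first state is irrelevant to `e`, and
independence of head and tail gives `Pr(ps, w 0 ∉ B) = Pr(Bᶜ) Pr(ps)`. If some condition is null, it
almost surely never occurs and `decidedLim` has measure one. -/

instance isProbabilityMeasure_seqMeasure : IsProbabilityMeasure (seqMeasure P) := by
  unfold seqMeasure; infer_instance

/-- The product measure is invariant under injective reindexing. -/
theorem measurePreserving_reindex {f : ℕ → ℕ} (hf : Function.Injective f) :
    MeasurePreserving (fun (w : ℕ → State E) i => w (f i)) (seqMeasure P) (seqMeasure P) where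
  measurable := by fun_prop
  map_eq := Measure.map_infinitePi_infinitePi_of_inj (P := fun _ : ℕ => P) hf

theorem seqMeasure_eval {A : Set (State E)} (hA : MeasurableSet A) (i : ℕ) :
    seqMeasure P {w | w i ∈ A} = P A :=
  (measurePreserving_eval_infinitePi (fun _ : ℕ => P) i).measure_preimage hA.nullMeasurableSet

/-- The first state is independent of the remaining ones. -/
theorem seqMeasure_head_inter_tail {A : Set (State E)} (hA : MeasurableSet A)
    {N : Set (ℕ → State E)} (hN : MeasurableSet N) :
    seqMeasure P {w | w 0 ∈ A ∧ (fun i => w (i + 1)) ∈ N} = P A * seqMeasure P N := by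
  have hind : iIndepFun (fun (i : ℕ) (w : ℕ → State E) => w i) (seqMeasure P) :=
    iIndepFun_infinitePi (P := fun _ : ℕ => P) (X := fun _ ω => ω) fun _ => measurable_id
  -- The independent coordinates are grouped into index `0` and the positive indices.
  have hI := indep_iSup_of_disjoint
    (m := fun i : ℕ => MeasurableSpace.comap (fun w : ℕ → State E => w i) inferInstance)
    (fun i => (measurable_pi_apply i).comap_le) hind
    (S := {0}) (T := Set.range Nat.succ) (by simp)
  have h0 : MeasurableSet[⨆ i ∈ ({0} : Set ℕ),
      MeasurableSpace.comap (fun w : ℕ → State E => w i) inferInstance]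
      {w : ℕ → State E | w 0 ∈ A} := by
    rw [iSup_singleton]
    exact ⟨A, hA, rfl⟩
  have h1 : MeasurableSet[⨆ i ∈ Set.range Nat.succ,
      MeasurableSpace.comap (fun w : ℕ → State E => w i) inferInstance]
      {w : ℕ → State E | (fun i => w (i + 1)) ∈ N} := by
    have : Measurable[⨆ i ∈ Set.range Nat.succ,
        MeasurableSpace.comap (fun w : ℕ → State E => w i) inferInstance]
        (fun (w : ℕ → State E) i => w (i + 1)) := by
      refine @measurable_pi_lambda _ _ _ (_) _ _ fun i => ?_
      rw [measurable_iff_comap_le]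
      exact le_iSup₂_of_le (i + 1) ⟨i, rfl⟩ le_rfl
    exact this hN
  have h := (Indep_iff _ _ _).1 hI _ _ h0 h1
  rw [seqMeasure_eval P hA] at h
  have h2 : seqMeasure P {w | (fun i => w (i + 1)) ∈ N} = seqMeasure P N :=
    (measurePreserving_reindex P (add_left_injective 1)).measure_preimage hN.nullMeasurableSet
  rw [h2] at h
  exact h

/-- An event of positive probability occurs almost surely. -/
theorem seqMeasure_forall_notMem_eq_zero {b : Set (State E)} (hb : MeasurableSet b)
    (hpos : 0 < P b) : seqMeasure P {w | ∀ i, w i ∉ b} = 0 := by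
  have hN : MeasurableSet {w : ℕ → State E | ∀ i, w i ∉ b} := by
    rw [Set.ofPred_forall]
    exact MeasurableSet.iInter fun i => (measurable_pi_apply (X := fun _ => State E) i) hb.compl
  -- Avoiding `b` forever means avoiding it now and along the tail, so its probability `x` satisfies
  -- `x = P bᶜ * x` with `P bᶜ < 1`.
  have h := seqMeasure_head_inter_tail P hb.compl hN
  have hset : {w : ℕ → State E | w 0 ∈ bᶜ ∧ (fun i => w (i + 1)) ∈ {w : ℕ → State E | ∀ i, w i ∉ b}}
      = {w | ∀ i, w i ∉ b} := by
    ext w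
    refine ⟨fun hw i => ?_, fun hw => ⟨hw 0, fun i => hw (i + 1)⟩⟩
    cases i with
    | zero => exact hw.1
    | succ i => exact hw.2 i
  rw [hset] at h
  by_contra hne
  have hlt : P bᶜ < 1 := by
    rw [prob_compl_eq_one_sub hb]
    exact ENNReal.sub_lt_self ENNReal.one_ne_top one_ne_zero hpos.ne'
  have := ENNReal.mul_lt_mul_left hne (measure_ne_top _ _) hlt
  rw [one_mul, ← h] at this
  exact lt_irrefl _ this

/-- A null event almost surely never occurs. -/
theorem ae_forall_notMem {b : Set (State E)} (hb : MeasurableSet b) (h0 : P b = 0) :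
    ∀ᵐ w ∂seqMeasure P, ∀ i, w i ∉ b := by
  rw [ae_all_iff]
  intro i
  rw [ae_iff]
  simpa using (seqMeasure_eval P hb i).trans h0

end SeqMeasure

/-! ### Finite approximations of the product space semantics -/

/-- Reversal of the first `n + 1` positions. -/
def flip (n i : ℕ) : ℕ := if i ≤ n then n - i else i

theorem flip_injective (n : ℕ) : Function.Injective (flip n) := by
  intro i j h
  unfold flip at h
  split_ifs at h <;> omega

theorem flip_of_le {n i : ℕ} (h : i ≤ n) : flip n i = n - i := if_pos h

namespace CExpr

/-- The product space semantics restricted to the first `n + 1` states. -/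
def approx : CExpr E → ℕ → Set (ℕ → State E)
  | simple a b, n => {w | ∃ j ≤ n, (∀ i < j, w i ∉ b) ∧ w j ∈ b ∩ a}
  | and e e', n => e.approx n ∩ e'.approx n
  | or e e', n => e.approx n ∪ e'.approx n
  | neg e, n => (e.approx n)ᶜ

/-- Some condition of `e` holds at the first state or at none of the first `n + 1` states. -/
def decided (e : CExpr E) (n : ℕ) : Set (ℕ → State E) :=
  {w | ∃ b ∈ e.conditions, w 0 ∈ b ∨ ∀ i ≤ n, w i ∉ b}

/-- Some condition of `e` holds at the first state or never. -/
def decidedLim (e : CExpr E) : Set (ℕ → State E) :=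
  {w | ∃ b ∈ e.conditions, w 0 ∈ b ∨ ∀ i, w i ∉ b}

theorem conditions_ne_nil (e : CExpr E) : e.conditions ≠ [] := by
  induction e <;> simp_all [conditions]

/-- Negation destroys monotonicity in `n`, but eventual agreement at each fixed sequence survives
all connectives. -/
theorem eventually_mem_approx_iff (e : CExpr E) (w : ℕ → State E) :
    ∀ᶠ n in atTop, (w ∈ e.approx n ↔ w ∈ e.ps) := by
  induction e with
  | simple a b =>
    by_cases h : w ∈ (simple a b).ps
    · obtain ⟨j, hj⟩ := Set.mem_iUnion.1 h
      filter_upwards [eventually_ge_atTop j] with n hn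
      exact iff_of_true ⟨j, hn, hj⟩ h
    · refine Eventually.of_forall fun n => iff_of_false ?_ h
      rintro ⟨j, -, hj⟩
      exact h (Set.mem_iUnion.2 ⟨j, hj⟩)
  | and e e' h h' =>
    filter_upwards [h, h'] with n hn hn'
    exact and_congr hn hn'
  | or e e' h h' =>
    filter_upwards [h, h'] with n hn hn'
    exact or_congr hn hn'
  | neg e h =>
    filter_upwards [h] with n hn
    exact not_congr hn

theorem eventually_mem_decided_iff (e : CExpr E) (w : ℕ → State E) :
    ∀ᶠ n in atTop, (w ∈ e.decided n ↔ w ∈ e.decidedLim) := by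
  have key : ∀ b : Set (State E), ∀ᶠ n in atTop, ((∀ i ≤ n, w i ∉ b) ↔ ∀ i, w i ∉ b) := by
    intro b
    by_cases h : ∀ i, w i ∉ b
    · exact Eventually.of_forall fun n => iff_of_true (fun i _ => h i) h
    · obtain ⟨i, hi⟩ := not_forall.1 h
      filter_upwards [eventually_ge_atTop i] with n hn
      exact iff_of_false (fun h' => hi (h' i hn)) h
  -- There are finitely many conditions, so one threshold serves them all.
  have hall : ∀ l : List (Set (State E)), ∀ᶠ n in atTop,
      ∀ b ∈ l, ((∀ i ≤ n, w i ∉ b) ↔ ∀ i, w i ∉ b) := by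
    intro l
    induction l with
    | nil => simp
    | cons b l ih =>
      filter_upwards [key b, ih] with n h1 h2
      exact List.forall_mem_cons.2 ⟨h1, h2⟩
  filter_upwards [hall e.conditions] with n hn
  exact exists_congr fun b => and_congr_right fun hb => or_congr_right (hn b hb)

/-- If no condition holds at the first state, that state may be dropped. -/
theorem mem_ps_iff_tail (e : CExpr E) (w : ℕ → State E) (h : ∀ b ∈ e.conditions, w 0 ∉ b) :
    w ∈ e.ps ↔ (fun i => w (i + 1)) ∈ e.ps := by
  induction e with
  | simple a b =>
    have hb : w 0 ∉ b := h b (by simp [conditions])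
    simp only [ps, Set.mem_iUnion]
    constructor
    · rintro ⟨j, hj, hjb⟩
      cases j with
      | zero => exact absurd hjb.1 hb
      | succ j => exact ⟨j, fun i hi => hj (i + 1) (by omega), hjb⟩
    · rintro ⟨j, hj, hjb⟩
      refine ⟨j + 1, fun i hi => ?_, hjb⟩
      cases i with
      | zero => exact hb
      | succ i => exact hj i (by omega)
  | and e e' ih ih' =>
    exact and_congr (ih fun b hb => h b (by simp [conditions, hb]))
      (ih' fun b hb => h b (by simp [conditions, hb]))
  | or e e' ih ih' =>
    exact or_congr (ih fun b hb => h b (by simp [conditions, hb]))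
      (ih' fun b hb => h b (by simp [conditions, hb]))
  | neg e ih => exact not_congr (ih h)

section Fintype

variable [Fintype E]

theorem measurableSet_event (b : Set (State E)) : MeasurableSet b := b.toFinite.measurableSet

theorem measurableSet_eval (b : Set (State E)) (i : ℕ) :
    MeasurableSet {w : ℕ → State E | w i ∈ b} :=
  measurable_pi_apply i (measurableSet_event b)

theorem measurableSet_approx (e : CExpr E) (n : ℕ) : MeasurableSet (e.approx n) := by
  induction e with
  | simple a b =>
    have : (simple a b).approx n = ⋃ j ∈ Set.Iic n,
        ((⋂ i ∈ Set.Iio j, {w : ℕ → State E | w i ∈ bᶜ}) ∩ {w | w j ∈ b ∩ a}) := by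
      ext w
      simp only [approx, Set.mem_ofPred_eq, Set.mem_iUnion, Set.mem_inter_iff, Set.mem_iInter,
        Set.mem_Iic, Set.mem_Iio, Set.mem_compl_iff, exists_prop]
    rw [this]
    exact MeasurableSet.biUnion (Set.to_countable _) fun j _ =>
      (MeasurableSet.biInter (Set.to_countable _) fun i _ => measurableSet_eval _ i).inter
        (measurableSet_eval _ j)
  | and e e' h h' => exact h.inter h'
  | or e e' h h' => exact h.union h'
  | neg e h => exact h.compl

theorem measurableSet_decided (e : CExpr E) (n : ℕ) : MeasurableSet (e.decided n) := by
  have : e.decided n = ⋃ b ∈ {b | b ∈ e.conditions},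
      ({w : ℕ → State E | w 0 ∈ b} ∪ ⋂ i ∈ Set.Iic n, {w : ℕ → State E | w i ∈ bᶜ}) := by
    ext w
    simp [decided]
  rw [this]
  exact MeasurableSet.biUnion (Set.to_countable _) fun b _ =>
    (measurableSet_eval _ 0).union
      (MeasurableSet.biInter (Set.to_countable _) fun i _ => measurableSet_eval _ i)

theorem measurableSet_ps (e : CExpr E) : MeasurableSet e.ps :=
  measurableSet_of_tendsto_indicator atTop e.measurableSet_approx e.eventually_mem_approx_iff

theorem measurableSet_decidedLim (e : CExpr E) : MeasurableSet e.decidedLim :=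
  measurableSet_of_tendsto_indicator atTop e.measurableSet_decided e.eventually_mem_decided_iff

/-! ### Temporal formulas on prefixes -/

theorem sat_firstTL_iff (e : CExpr E) (n : ℕ) (w : ℕ → State E) :
    e.firstTL.Sat (fun i : Fin (n + 1) => w i) (Fin.last n) ↔ w ∈ e.approx n := by
  induction e with
  | simple a b =>
    simp only [firstTL, TL.once, TL.Sat, TL.sat_and, TL.sat_ofEvent, approx, Set.mem_ofPred_eq]
    constructor
    · rintro ⟨t, -, ⟨ha, hb, hprev⟩, -⟩
      refine ⟨t, by omega, fun i hi hib => hprev ?_, hb, ha⟩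
      -- As `i < t`, position `t - 1` exists, and the earlier occurrence `i` of `b` makes `◇ b` true
      -- there.
      exact ⟨⟨t - 1, by omega⟩, by simp; omega, ⟨i, by omega⟩, by simp [Fin.le_def]; omega, hib,
        by simp⟩
    · rintro ⟨j, hj, hlt, hb, ha⟩
      refine ⟨⟨j, by omega⟩, Fin.le_last _, ⟨ha, hb, ?_⟩, by simp⟩
      rintro ⟨t, ht, u, hu, hub, -⟩
      simp only [Fin.le_def] at hu ht
      exact hlt u (by omega) hub
  | and e e' h h' =>
    rw [firstTL, TL.sat_and]
    exact and_congr h h'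
  | or e e' h h' => exact or_congr h h'
  | neg e h => exact not_congr h

/-- The last `b`-state of a prefix is the first one of its reversal: the witness `t` of `Since`
corresponds to `j = n - t`. -/
theorem sat_revTL_iff (e : CExpr E) (n : ℕ) (w : ℕ → State E) :
    e.revTL.Sat (fun i : Fin (n + 1) => w i) (Fin.last n) ↔
      (fun i => w (flip n i)) ∈ e.approx n := by
  induction e with
  | simple a b =>
    simp only [revTL, TL.Sat, TL.sat_and, TL.sat_ofEvent, approx, Set.mem_ofPred_eq]
    constructor
    · rintro ⟨t, -, ⟨ha, hb⟩, hu⟩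
      have ht : flip n (n - t) = t := by rw [flip_of_le (by omega)]; omega
      refine ⟨n - t, by omega, fun i hi => ?_, ?_⟩
      · rw [flip_of_le (by omega)]
        exact hu ⟨n - i, by omega⟩ (by simp [Fin.lt_def]; omega) (Fin.le_last _)
      · rw [ht]
        exact ⟨hb, ha⟩
    · rintro ⟨j, hj, hlt, hb, ha⟩
      rw [flip_of_le hj] at hb ha
      refine ⟨⟨n - j, by omega⟩, Fin.le_last _, ⟨ha, hb⟩, fun u hu _ => ?_⟩
      simp only [Fin.lt_def] at hu
      have h := hlt (n - u) (by omega)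
      rw [flip_of_le (by omega), Nat.sub_sub_self (by omega)] at h
      exact h
  | and e e' h h' =>
    rw [revTL, TL.sat_and]
    exact and_congr h h'
  | or e e' h h' => exact or_congr h h'
  | neg e h => exact not_congr h

theorem sat_sparse_given_iff (e : CExpr E) (n : ℕ) (w : ℕ → State E) :
    e.sparse.given.Sat (fun i : Fin (n + 1) => w i) (Fin.last n) ↔
      (fun i => w (flip n i)) ∈ e.decided n := by
  simp only [sparse, TL.sat_bigOr, List.mem_map, exists_exists_and_eq_and, TL.Sat, TL.once,
    TL.sat_ofEvent, decided, Set.mem_ofPred_eq]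
  refine exists_congr fun b => and_congr_right fun _ => or_congr ?_ ?_
  · rw [flip_of_le (Nat.zero_le n)]
    rfl
  · constructor
    · intro h i hi hib
      rw [flip_of_le hi] at hib
      exact h ⟨⟨n - i, by omega⟩, Fin.le_last _, hib, by simp⟩
    · rintro h ⟨t, -, ht, -⟩
      refine h (n - t) (by omega) ?_
      rw [flip_of_le (by omega), Nat.sub_sub_self (by omega)]
      exact ht

end Fintype

end CExpr

/-! ### Values of conditional objects on prefixes -/

theorem valueAt_eq_one_iff (c : TLTL E) (n : ℕ) (w : ℕ → State E) :
    valueAt c.obj n w = Three.one ↔ c.concl.Sat (fun i : Fin (n + 1) => w i) (Fin.last n) ∧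
      c.given.Sat (fun i : Fin (n + 1) => w i) (Fin.last n) := by
  simp only [valueAt, TLTL.obj]
  split_ifs <;> simp [*]

theorem valueAt_eq_undef_iff (c : TLTL E) (n : ℕ) (w : ℕ → State E) :
    valueAt c.obj n w = Three.undef ↔
      ¬ c.given.Sat (fun i : Fin (n + 1) => w i) (Fin.last n) := by
  simp only [valueAt, TLTL.obj]
  split_ifs <;> simp [*]

theorem valueAt_defined_iff (c : TLTL E) (n : ℕ) (w : ℕ → State E) :
    (valueAt c.obj n w = Three.zero ∨ valueAt c.obj n w = Three.one) ↔
      c.given.Sat (fun i : Fin (n + 1) => w i) (Fin.last n) := by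
  simp only [valueAt, TLTL.obj]
  split_ifs <;> simp [*]

/-! ### Limits -/

section Limits

variable (P : Measure (State E)) [IsProbabilityMeasure P]

theorem tendsto_seqMeasure_real {s : ℕ → Set (ℕ → State E)} {t : Set (ℕ → State E)}
    (hs : ∀ n, MeasurableSet (s n)) (h : ∀ w, ∀ᶠ n in atTop, (w ∈ s n ↔ w ∈ t)) :
    Tendsto (fun n => (seqMeasure P).real (s n)) atTop (𝓝 ((seqMeasure P).real t)) :=
  (ENNReal.tendsto_toReal (measure_ne_top _ _)).comp
    (tendsto_measure_of_tendsto_indicator_of_isFiniteMeasure atTop (seqMeasure P) hs h)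

/-- This moves events anchored at the end of the prefix, which need not converge pointwise, to
events anchored at position `0`. -/
theorem seqMeasure_real_flip (n : ℕ) {s : Set (ℕ → State E)} (hs : MeasurableSet s) :
    (seqMeasure P).real {w | (fun i => w (flip n i)) ∈ s} = (seqMeasure P).real s :=
  congrArg ENNReal.toReal
    ((measurePreserving_reindex P (flip_injective n)).measure_preimage hs.nullMeasurableSet)

variable [Fintype E] (e : CExpr E)

theorem probAt_sparse_one (n : ℕ) :
    probAt P e.sparse.obj n Three.one = (seqMeasure P).real (e.approx n ∩ e.decided n) := by
  rw [← seqMeasure_real_flip P n ((e.measurableSet_approx n).inter (e.measurableSet_decided n))]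
  simp only [probAt, valueAt_eq_one_iff, e.sat_sparse_given_iff]
  simp only [CExpr.sparse, e.sat_revTL_iff, Set.mem_inter_iff]

theorem probDefinedAt_sparse (n : ℕ) :
    probDefinedAt P e.sparse.obj n = (seqMeasure P).real (e.decided n) := by
  rw [← seqMeasure_real_flip P n (e.measurableSet_decided n)]
  simp only [probDefinedAt, valueAt_defined_iff, e.sat_sparse_given_iff]

theorem probAt_sparse_undef (n : ℕ) :
    probAt P e.sparse.obj n Three.undef = (seqMeasure P).real (e.decided n)ᶜ := by
  rw [← seqMeasure_real_flip P n (e.measurableSet_decided n).compl]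
  simp only [probAt, valueAt_eq_undef_iff, e.sat_sparse_given_iff, Set.mem_compl_iff]

/-- If all conditions have positive probability, then almost surely a sequence is decided exactly
when some condition holds at its first state. -/
theorem decidedLim_ae_eq (h : ∀ b ∈ e.conditions, 0 < P b) :
    e.decidedLim =ᵐ[seqMeasure P] {w | w 0 ∈ ⋃ b ∈ e.conditions, b} := by
  have hae : ∀ᵐ w ∂seqMeasure P, ∀ b ∈ {b | b ∈ e.conditions}, ¬ ∀ i, w i ∉ b := by
    rw [ae_ball_iff (Set.to_countable _)]
    intro b hb
    rw [ae_iff]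
    simpa using seqMeasure_forall_notMem_eq_zero P (CExpr.measurableSet_event b) (h b hb)
  filter_upwards [hae] with w hw
  refine propext ?_
  change (∃ b ∈ e.conditions, w 0 ∈ b ∨ ∀ i, w i ∉ b) ↔ w 0 ∈ ⋃ b ∈ e.conditions, b
  rw [Set.mem_iUnion₂]
  exact exists_congr fun b => ⟨fun ⟨hb, hw'⟩ => ⟨hb, hw'.resolve_right (hw b hb)⟩,
    fun ⟨hb, hw'⟩ => ⟨hb, Or.inl hw'⟩⟩

/-- If some condition is null, then almost every sequence is decided. -/
theorem decidedLim_ae_eq_univ {b : Set (State E)} (hb : b ∈ e.conditions) (h : P b = 0) :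
    e.decidedLim =ᵐ[seqMeasure P] Set.univ := by
  filter_upwards [ae_forall_notMem P (CExpr.measurableSet_event b) h] with w hw
  exact eq_true ⟨b, hb, Or.inr hw⟩

/-- The event that some condition holds at the first state is independent of `e`. -/
theorem seqMeasure_real_ps_inter_head :
    (seqMeasure P).real (e.ps ∩ {w | w 0 ∈ ⋃ b ∈ e.conditions, b}) =
      (seqMeasure P).real e.ps * P.real (⋃ b ∈ e.conditions, b) := by
  set B := ⋃ b ∈ e.conditions, b
  have hsplit := measureReal_inter_add_sdiff (μ := seqMeasure P) (s := e.ps)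
    (CExpr.measurableSet_eval B 0)
  have hdiff : e.ps \ {w | w 0 ∈ B} = {w | w 0 ∈ Bᶜ ∧ (fun i => w (i + 1)) ∈ e.ps} := by
    ext w
    have key : w 0 ∉ B → (w ∈ e.ps ↔ (fun i => w (i + 1)) ∈ e.ps) := fun hw =>
      e.mem_ps_iff_tail w fun b hb hwb => hw (Set.mem_iUnion₂.2 ⟨b, hb, hwb⟩)
    exact ⟨fun hw => ⟨hw.2, (key hw.2).1 hw.1⟩, fun hw => ⟨(key hw.1).2 hw.2, hw.1⟩⟩
  have htail : (seqMeasure P).real (e.ps \ {w | w 0 ∈ B}) =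
      P.real Bᶜ * (seqMeasure P).real e.ps := by
    rw [hdiff, measureReal_def,
      seqMeasure_head_inter_tail P (CExpr.measurableSet_event _) e.measurableSet_ps,
      ENNReal.toReal_mul]
    rfl
  -- With `x` the measure of `e.ps`, `hsplit` now reads: the wanted measure plus `(1 - P.real B) *
  -- x` equals `x`.
  rw [htail, probReal_compl_eq_one_sub (CExpr.measurableSet_event B)] at hsplit
  linarith

theorem seqMeasure_real_decidedLim (h : ∀ b ∈ e.conditions, 0 < P b) :
    (seqMeasure P).real e.decidedLim = P.real (⋃ b ∈ e.conditions, b) := by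
  rw [measureReal_congr (decidedLim_ae_eq P e h), measureReal_def,
    seqMeasure_eval P (CExpr.measurableSet_event _)]
  rfl

/-- Being decided has positive probability and is independent of `e`. -/
theorem decidedLim_pos_and_indep :
    0 < (seqMeasure P).real e.decidedLim ∧ (seqMeasure P).real (e.ps ∩ e.decidedLim) =
      (seqMeasure P).real e.ps * (seqMeasure P).real e.decidedLim := by
  by_cases h : ∀ b ∈ e.conditions, 0 < P b
  · have hD := seqMeasure_real_decidedLim P e h
    refine ⟨?_, ?_⟩
    · obtain ⟨b, hb⟩ := List.exists_mem_of_ne_nil _ e.conditions_ne_nil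
      rw [hD]
      exact ENNReal.toReal_pos
        ((h b hb).trans_le (measure_mono (Set.subset_biUnion_of_mem (u := id) hb))).ne'
        (measure_ne_top _ _)
    · rw [hD, ← seqMeasure_real_ps_inter_head]
      exact measureReal_congr ((ae_eq_refl _).inter (decidedLim_ae_eq P e h))
  · push Not at h
    obtain ⟨b, hb, h0⟩ := h
    have hD := decidedLim_ae_eq_univ P e hb (le_zero_iff.1 h0)
    rw [measureReal_congr hD, measureReal_congr ((ae_eq_refl e.ps).inter hD)]
    simp

theorem hasAsympProb_sparse : HasAsympProb P e.sparse.obj (prPS P e) := by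
  obtain ⟨hpos, hind⟩ := decidedLim_pos_and_indep P e
  have hden : Tendsto (fun n => probDefinedAt P e.sparse.obj n) atTop
      (𝓝 ((seqMeasure P).real e.decidedLim)) := by
    simp only [probDefinedAt_sparse]
    exact tendsto_seqMeasure_real P e.measurableSet_decided e.eventually_mem_decided_iff
  have hnum : Tendsto (fun n => probAt P e.sparse.obj n Three.one) atTop
      (𝓝 ((seqMeasure P).real (e.ps ∩ e.decidedLim))) := by
    simp only [probAt_sparse_one]
    refine tendsto_seqMeasure_real P
      (fun n => (e.measurableSet_approx n).inter (e.measurableSet_decided n)) fun w => ?_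
    filter_upwards [e.eventually_mem_approx_iff w, e.eventually_mem_decided_iff w] with n h h'
    exact and_congr h h'
  refine ⟨hden.eventually_ne hpos.ne', ?_⟩
  have h := hnum.div hden hpos.ne'
  rwa [hind, mul_div_cancel_right₀ _ hpos.ne'] at h

theorem hasAsympProb_first : HasAsympProb P e.first.obj (prPS P e) := by
  have hden : ∀ n, probDefinedAt P e.first.obj n = 1 := fun n => by
    simp [probDefinedAt, valueAt_defined_iff, CExpr.first, TL.Sat]
  have hnum : ∀ n, probAt P e.first.obj n Three.one = (seqMeasure P).real (e.approx n) :=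
    fun n => by
      simp [probAt, valueAt_eq_one_iff, CExpr.first, TL.Sat, e.sat_firstTL_iff]
  refine ⟨Eventually.of_forall fun n => by simp [hden], ?_⟩
  simp only [hden, hnum, div_one]
  exact tendsto_seqMeasure_real P e.measurableSet_approx e.eventually_mem_approx_iff

theorem tendsto_probAt_sparse_undef (h : ∀ b ∈ e.conditions, 0 < P b) :
    Tendsto (fun n => probAt P e.sparse.obj n Three.undef) atTop
      (𝓝 (1 - P.real (⋃ b ∈ e.conditions, b))) := by
  rw [← seqMeasure_real_decidedLim P e h, ← probReal_compl_eq_one_sub e.measurableSet_decidedLim]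
  simp only [probAt_sparse_undef]
  refine tendsto_seqMeasure_real P (fun n => (e.measurableSet_decided n).compl) fun w => ?_
  filter_upwards [e.eventually_mem_decided_iff w] with n hn
  exact not_congr hn

end Limits

/-! ### Positive probability of being undefined, and failure of the embedding property -/

/-- A measure under which the basic event `x` has probability `1 / 2`. -/
theorem exists_measure_basic_eq_half [Fintype E] (x : E) :
    ∃ (P : Measure (State E)) (_ : IsProbabilityMeasure P), P (basic x) = 2⁻¹ := by
  -- A fair coin chooses between the all-true and the all-false state.
  refine ⟨(2⁻¹ : ENNReal) • Measure.dirac (fun _ => true) +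
    (2⁻¹ : ENNReal) • Measure.dirac (fun _ => false), ⟨?_⟩, ?_⟩
  · simp [ENNReal.inv_two_add_inv_two]
  · simp [basic]

theorem exists_tendsto_probAt_sparse_undef_pos [Fintype E] (x : E) :
    ∃ (P : Measure (State E)) (_ : IsProbabilityMeasure P) (e : CExpr E) (q : ℝ), 0 < q ∧
      Tendsto (fun n => probAt P e.sparse.obj n Three.undef) atTop (𝓝 q) := by
  obtain ⟨P, hP, hx⟩ := exists_measure_basic_eq_half x
  refine ⟨P, hP, .simple (basic x) (basic x), _, ?_, tendsto_probAt_sparse_undef P _ ?_⟩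
  · simp only [CExpr.conditions, List.mem_singleton, Set.iUnion_iUnion_eq_left, measureReal_def,
      hx]
    norm_num
  · simp [CExpr.conditions, hx]

theorem ps_simple_empty (b : Set (State E)) : (CExpr.simple ∅ b).ps = ∅ := by
  simp [CExpr.ps]

theorem sparse_obj_simple_basic_ne [Fintype E] {a b : E} (hab : a ≠ b) :
    (CExpr.simple ∅ (basic a)).sparse.obj ≠ (CExpr.simple ∅ (basic b)).sparse.obj := by
  classical
  intro h
  -- All basic events hold at position `0`, only `a` later. On the prefix of length two, `a` holds
  -- at the end, whereas `b` has occurred but fails at the end; so only the conditional given `a` is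
  -- defined.
  let w : ℕ → State E := fun i x => i == 0 || x == a
  have ha : (fun i => w (flip 1 i)) ∈ (CExpr.simple ∅ (basic a)).decided 1 :=
    ⟨basic a, by simp [CExpr.conditions], Or.inl (by simp [basic, w])⟩
  have hb : (fun i => w (flip 1 i)) ∉ (CExpr.simple ∅ (basic b)).decided 1 := by
    rintro ⟨c, hc, hw⟩
    obtain rfl : c = basic b := by simpa [CExpr.conditions] using hc
    rcases hw with hw | hw
    · simp [basic, w, flip, hab.symm] at hw
    · exact hw 1 le_rfl (by simp [basic, w, flip])
  rw [← CExpr.sat_sparse_given_iff, ← valueAt_defined_iff] at ha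
  rw [← CExpr.sat_sparse_given_iff, ← valueAt_defined_iff, ← h] at hb
  exact hb ha

end CondTL

theorem mainTheorem3 {E : Type*} [Fintype E] :
    -- asymptotic probabilities of the sparse reverse interpretation and of the first embedding
    (∀ (P : Measure (CondTL.State E)) [IsProbabilityMeasure P] (e : CondTL.CExpr E),
      CondTL.HasAsympProb P e.sparse.obj (CondTL.prPS P e) ∧
      CondTL.HasAsympProb P e.first.obj (CondTL.prPS P e)) ∧
    -- the asymptotic probability of being undefined
    (∀ (P : Measure (CondTL.State E)) [IsProbabilityMeasure P] (e : CondTL.CExpr E),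
      (∀ b ∈ e.conditions, 0 < P b) →
      Tendsto (fun n => CondTL.probAt P e.sparse.obj n CondTL.Three.undef) atTop
        (𝓝 (1 - P.real (⋃ b ∈ e.conditions, b)))) ∧
    -- it is positive for some expressions and probability assignments
    (Nonempty E → ∃ (P : Measure (CondTL.State E)) (_ : IsProbabilityMeasure P)
      (e : CondTL.CExpr E) (q : ℝ), 0 < q ∧
      Tendsto (fun n => CondTL.probAt P e.sparse.obj n CondTL.Three.undef) atTop (𝓝 q)) ∧
    -- the interpretation is not an embedding
    (∀ a b : E, a ≠ b →
      (CondTL.CExpr.simple ∅ (CondTL.basic a)).ps = (CondTL.CExpr.simple ∅ (CondTL.basic b)).ps ∧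
      (CondTL.CExpr.simple ∅ (CondTL.basic a)).sparse.obj ≠
        (CondTL.CExpr.simple ∅ (CondTL.basic b)).sparse.obj) := by
  refine ⟨fun P _ e => ⟨CondTL.hasAsympProb_sparse P e, CondTL.hasAsympProb_first P e⟩,
    fun P _ e h => CondTL.tendsto_probAt_sparse_undef P e h,
    fun ⟨x⟩ => CondTL.exists_tendsto_probAt_sparse_undef_pos x,
    fun a b hab => ⟨?_, CondTL.sparse_obj_simple_basic_ne hab⟩⟩
  rw [CondTL.ps_simple_empty, CondTL.ps_simple_empty]
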